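/- **Theorem.** There are absolute constants $C>0$ and $K>0$ such that the following holds. Let $G=(V,F,\mathsf w)$ be a connected simple graph with $n=|V|$ vertices and edge weights $\mathsf w:F\to\mathbb R_{\ge 0}$, let $1/n\le\epsilon\le 1/2$, and let $\lambda\ge C\,\epsilon^{-4}\log^3 n$ (in particular, $\lambda=\Theta(\epsilon^{-4}\log^3 n)$ with a sufficiently large constant is allowed). Let $L_G$ be the weighted Laplacian of $G$, so that $x^\top L_Gx=\sum_{(u,v)\in F}\mathsf w(u,v)(x_u-x_v)^2$, and for an edge $f=(u,v)$ let $R_G(f)=(\chi_u-\chi_v)^\top L_G^{+}(\chi_u-\chi_v)$ be its effective resistance, where $L_G^{+}$ is the Moore-Penrose pseudo-inverse and $\chi_u$ is the indicator vector of $u$. For every $f\in F$ let $$p(f)=\min\bigl(1,\ \lambda\cdot\mathsf w(f)\cdot R_G(f)\bigr).$$ Sample each edge $f\in F$ independently with probability $p(f)$; set $\widetilde{\mathsf w}(f)=\mathsf w(f)/p(f)$ if $f$ is sampled and $\widetilde{\mathsf w}(f)=0$ otherwise, and let $\widetilde G=(V,\widetilde F,\widetilde{\mathsf w})$ with $\widetilde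 F=\{f\in F:\widetilde{\mathsf w}(f)>0\}$. Then with probability at least $1-K\,\frac{\log n}{n}$, $\widetilde G$ is an $\epsilon$-spectral sparsifier of $G$, that is, for every $x\in\mathbb R^V$, $$(1-\epsilon)\,x^\top L_Gx\ \le\ x^\top L_{\widetilde G}x\ \le\ (1+\epsilon)\,x^\top L_Gx.$$ -/

import Mathlib

open MeasureTheory ProbabilityTheory
open scoped Matrix

noncomputable section

/-- `B` is a Moore-Penrose pseudo-inverse of the real matrix `A` (the four Penrose equations). -/
structure IsMoorePenrose {V : Type*} [Fintype V] (A B : Matrix V V ℝ) : Prop where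
  mul_mul_left : A * B * A = A
  mul_mul_right : B * A * B = B
  symm_left : (A * B)ᵀ = A * B
  symm_right : (B * A)ᵀ = B * A

theorem IsMoorePenrose.unique {V : Type*} [Fintype V] {A B C : Matrix V V ℝ}
    (hB : IsMoorePenrose A B) (hC : IsMoorePenrose A C) : B = C := by
  have h1 : A * B = A * C := by
    calc A * B = (A * C * A) * B := by rw [hC.mul_mul_left]
      _ = (A * C) * (A * B) := by simp only [Matrix.mul_assoc]
      _ = (A * C)ᵀ * (A * B)ᵀ := by rw [hC.symm_left, hB.symm_left]
      _ = (A * B * A * C)ᵀ := by rw [← Matrix.transpose_mul]; simp only [Matrix.mul_assoc]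
      _ = A * C := by rw [hB.mul_mul_left, hC.symm_left]
  have h2 : B * A = C * A := by
    calc B * A = B * (A * C * A) := by rw [hC.mul_mul_left]
      _ = (B * A) * (C * A) := by simp only [Matrix.mul_assoc]
      _ = (B * A)ᵀ * (C * A)ᵀ := by rw [hC.symm_right, hB.symm_right]
      _ = (C * (A * B * A))ᵀ := by rw [← Matrix.transpose_mul]; simp only [Matrix.mul_assoc]
      _ = C * A := by rw [hB.mul_mul_left, hC.symm_right]
  calc B = B * A * B := hB.mul_mul_right.symm
    _ = C * (A * B) := by rw [h2, Matrix.mul_assoc]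
    _ = C * A * C := by rw [h1, Matrix.mul_assoc]
    _ = C := hC.mul_mul_right

theorem exists_isMoorePenrose_of_isSymm {V : Type*} [Fintype V] {A : Matrix V V ℝ}
    (hA : A.IsSymm) : ∃ B, IsMoorePenrose A B := by
  classical
  obtain ⟨U, d, hUU, hAU⟩ : ∃ (U : Matrix V V ℝ) (d : V → ℝ),
      Uᵀ * U = 1 ∧ A = U * Matrix.diagonal d * Uᵀ := by
    have hH : A.IsHermitian := by
      rw [Matrix.IsHermitian, Matrix.conjTranspose_eq_transpose_of_trivial]; exact hA
    refine ⟨hH.eigenvectorUnitary, hH.eigenvalues, ?_, ?_⟩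
    · have := Unitary.coe_star_mul_self hH.eigenvectorUnitary
      rwa [Matrix.star_eq_conjTranspose, Matrix.conjTranspose_eq_transpose_of_trivial] at this
    · have := hH.spectral_theorem
      rw [Unitary.conjStarAlgAut_apply, Matrix.star_eq_conjTranspose,
        Matrix.conjTranspose_eq_transpose_of_trivial] at this
      exact this
  have key : ∀ a b : V → ℝ, (U * Matrix.diagonal a * Uᵀ) * (U * Matrix.diagonal b * Uᵀ)
      = U * Matrix.diagonal (fun i => a i * b i) * Uᵀ := by
    intro a b
    calc (U * Matrix.diagonal a * Uᵀ) * (U * Matrix.diagonal b * Uᵀ)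
        = U * Matrix.diagonal a * (Uᵀ * U) * Matrix.diagonal b * Uᵀ := by
          simp only [Matrix.mul_assoc]
      _ = _ := by rw [hUU, Matrix.mul_one, Matrix.mul_assoc U, Matrix.diagonal_mul_diagonal]
  have symm : ∀ a : V → ℝ, (U * Matrix.diagonal a * Uᵀ)ᵀ = U * Matrix.diagonal a * Uᵀ := by
    intro a
    simp only [Matrix.transpose_mul, Matrix.transpose_transpose, Matrix.diagonal_transpose,
      Matrix.mul_assoc]
  subst hAU
  refine ⟨U * Matrix.diagonal (fun i => (d i)⁻¹) * Uᵀ, ?_, ?_, ?_, ?_⟩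
  · rw [key, key]
    simp only [mul_inv_mul_cancel]
  · rw [key, key]
    congr 3
    ext i
    by_cases h : d i = 0 <;> simp [h]
  · rw [key, symm]
  · rw [key, symm]

open scoped Classical in
/-- The Moore-Penrose pseudo-inverse. It is unique, and it exists for every symmetric matrix
(see `moorePenrose_spec`); the default value `0` is never used for graph Laplacians. -/
def moorePenrose {V : Type*} [Fintype V] (A : Matrix V V ℝ) : Matrix V V ℝ :=
  if h : ∃ B, IsMoorePenrose A B then h.choose else 0

theorem moorePenrose_spec {V : Type*} [Fintype V] {A : Matrix V V ℝ} (hA : A.IsSymm) :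
    IsMoorePenrose A (moorePenrose A) := by
  have h := exists_isMoorePenrose_of_isSymm hA
  rw [moorePenrose, dif_pos h]
  exact h.choose_spec

open scoped Classical in
/-- The weighted degree of `u`: the sum of the weights of the incident edges. Weights are functions
on unordered pairs, of which only the values on edges of `G` are ever used. -/
def weightedDegree {V : Type*} [Fintype V] (G : SimpleGraph V) (w : Sym2 V → ℝ) (u : V) : ℝ :=
  ∑ v, if G.Adj u v then w s(u, v) else 0

open scoped Classical in
/-- The Laplacian of the weighted graph `(V, E(G), w)`. -/
def weightedLaplacian {V : Type*} [Fintype V] (G : SimpleGraph V) (w : Sym2 V → ℝ) :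
    Matrix V V ℝ :=
  Matrix.of fun u v =>
    if u = v then weightedDegree G w u else if G.Adj u v then - w s(u, v) else 0

theorem weightedLaplacian_isSymm {V : Type*} [Fintype V] (G : SimpleGraph V) (w : Sym2 V → ℝ) :
    (weightedLaplacian G w).IsSymm := by
  ext u v
  by_cases h : u = v
  · subst h; rfl
  · by_cases h2 : G.Adj u v
    · simp [weightedLaplacian, h, Ne.symm h, h2, h2.symm, Sym2.eq_swap (a := u) (b := v)]
    · have h3 : ¬ G.Adj v u := fun h3 => h2 h3.symm
      simp [weightedLaplacian, h, Ne.symm h, h2, h3]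

/-- The quadratic form `xᵀ L x` of the Laplacian of a weighted graph. -/
def energy {V : Type*} [Fintype V] (G : SimpleGraph V) (w : Sym2 V → ℝ) (x : V → ℝ) : ℝ :=
  x ⬝ᵥ (weightedLaplacian G w *ᵥ x)

/-- The effective resistance `(χ_u - χ_v)ᵀ L⁺ (χ_u - χ_v)` of a pair of vertices. -/
def effectiveResistance {V : Type*} [Fintype V] [DecidableEq V] (G : SimpleGraph V)
    (w : Sym2 V → ℝ) (u v : V) : ℝ :=
  (Pi.single u 1 - Pi.single v 1 : V → ℝ) ⬝ᵥ
    (moorePenrose (weightedLaplacian G w) *ᵥ (Pi.single u 1 - Pi.single v 1 : V → ℝ))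

theorem effectiveResistance_comm {V : Type*} [Fintype V] [DecidableEq V] (G : SimpleGraph V)
    (w : Sym2 V → ℝ) (u v : V) :
    effectiveResistance G w u v = effectiveResistance G w v u := by
  unfold effectiveResistance
  rw [← neg_sub (Pi.single v 1 : V → ℝ) (Pi.single u 1 : V → ℝ), Matrix.mulVec_neg,
    neg_dotProduct_neg]

/-- The effective resistance as a function of an unordered pair. -/
def edgeResistance {V : Type*} [Fintype V] [DecidableEq V] (G : SimpleGraph V)
    (w : Sym2 V → ℝ) (f : Sym2 V) : ℝ :=
  Sym2.lift ⟨effectiveResistance G w, effectiveResistance_comm G w⟩ f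

/-- The sampling probability `p(f) = min(1, lam * w(f) * R_G(f))`. -/
def sampleProb {V : Type*} [Fintype V] [DecidableEq V] (G : SimpleGraph V)
    (w : Sym2 V → ℝ) (lam : ℝ) (f : Sym2 V) : ℝ :=
  min 1 (lam * w f * edgeResistance G w f)

open scoped Classical in
/-- The new weights when `S` is the set of sampled edges: `w(f) / p(f)` on sampled edges,
and `0` on edges that are not sampled. -/
def sampledWeight {V : Type*} [Fintype V] [DecidableEq V] (G : SimpleGraph V)
    (w : Sym2 V → ℝ) (lam : ℝ) (S : Set (Sym2 V)) (f : Sym2 V) : ℝ :=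
  if f ∈ S then w f / sampleProb G w lam f else 0

/-- The subgraph of `G` formed by the edges of positive new weight. -/
def reweightedSubgraph {V : Type*} (G : SimpleGraph V) (w' : Sym2 V → ℝ) : SimpleGraph V :=
  SimpleGraph.fromEdgeSet {f | f ∈ G.edgeSet ∧ 0 < w' f}

/-- The reweighted subgraph of `(V, E(G), w)` given by the nonnegative weights `w'` is an
`ε`-spectral sparsifier: its quadratic form is within a factor `1 ± ε` for every vector. -/
def IsSpectralSparsifier {V : Type*} [Fintype V] (ε : ℝ) (G : SimpleGraph V)
    (w w' : Sym2 V → ℝ) : Prop :=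
  (∀ f ∈ G.edgeSet, 0 ≤ w' f) ∧
    ∀ x : V → ℝ,
      (1 - ε) * energy G w x ≤ energy (reweightedSubgraph G w') w' x ∧
      energy (reweightedSubgraph G w') w' x ≤ (1 + ε) * energy G w x

end

/-! ### The Lie-Trotter formula and the Golden-Thompson inequality -/

/-! Write `L⁺ = Bᵀ B` and give each edge the vector `a f = √(w f) • B (χ_u - χ_v)`. Then `a f` has
squared length `w f * R f`, the sum of the matrices `(a f)(a f)ᵀ` is at most the identity, and `y =
B L x` satisfies `‖y‖² = xᵀ L x` (`exists_isotropic_vectors`). The sampling error of the energy at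
`x` becomes `∑ (1_f / p f - 1) (a f ⬝ᵥ y)²`, so it suffices to bound a random sum of independent
rank-one matrices.

This is done by the exponential moment method of Ahlswede and Winter. Golden-Thompson
(`trace_exp_add_le`) splits off one summand at a time, and the exponential of a rank-one matrix is
explicit, so only scalar moment bounds are needed to get an expected trace at most `n`
(`integral_trace_exp_sum_le`). When `p f < 1` and `a f ≠ 0`, `‖a f‖² / p f = 1 / lam`: sampling caps
the size of each summand. Edges with `p f = 1` are almost surely sampled and contribute no error.
Markov's inequality at level `n²`, used for both signs of the exponent, gives failure probability at
most `2 / n` once `ε² lam ≥ 8 log n`, which the hypothesis on `lam` implies. -/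

theorem norm_pow_sub_pow_le {𝔸 : Type*} [NormedRing 𝔸] [NormOneClass 𝔸] {x y : 𝔸} {c : ℝ}
    (hx : ‖x‖ ≤ c) (hy : ‖y‖ ≤ c) (n : ℕ) :
    ‖x ^ (n + 1) - y ^ (n + 1)‖ ≤ (n + 1) * c ^ n * ‖x - y‖ := by
  have hc : 0 ≤ c := (norm_nonneg x).trans hx
  induction n with
  | zero => simp
  | succ n ih =>
    have h : x ^ (n + 1 + 1) - y ^ (n + 1 + 1)
        = x ^ (n + 1) * (x - y) + (x ^ (n + 1) - y ^ (n + 1)) * y := by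
      rw [pow_succ x, pow_succ y]; noncomm_ring
    calc ‖x ^ (n + 1 + 1) - y ^ (n + 1 + 1)‖
        ≤ ‖x ^ (n + 1)‖ * ‖x - y‖ + ‖x ^ (n + 1) - y ^ (n + 1)‖ * ‖y‖ := by
          rw [h]; exact (norm_add_le _ _).trans (add_le_add (norm_mul_le _ _) (norm_mul_le _ _))
      _ ≤ c ^ (n + 1) * ‖x - y‖ + ((n + 1) * c ^ n * ‖x - y‖) * c := by
          gcongr
          exact (norm_pow_le _ _).trans (by gcongr)
      _ = _ := by push_cast; ring

theorem NormedSpace.norm_exp_le_exp_norm {𝔸 : Type*} [NormedRing 𝔸] [NormOneClass 𝔸]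
    [NormedAlgebra ℝ 𝔸] [CompleteSpace 𝔸] (x : 𝔸) : ‖NormedSpace.exp x‖ ≤ Real.exp ‖x‖ := by
  have h1 := NormedSpace.exp_series_hasSum_exp' (𝕂 := ℝ) x
  have h2 := NormedSpace.exp_series_hasSum_exp' (𝕂 := ℝ) ‖x‖
  rw [← Real.exp_eq_exp_ℝ] at h2
  rw [← h1.tsum_eq, ← h2.tsum_eq]
  refine tsum_of_norm_bounded h2.summable.hasSum fun n => ?_
  rw [norm_smul, smul_eq_mul, Real.norm_of_nonneg (by positivity)]
  gcongr
  exact norm_pow_le _ _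

-- The defect `exp (t(a+b)) - exp (ta) exp (tb)` vanishes with its derivative at `t = 0`, so it is
-- `o(t)`. Taking `(n+1)`-st powers at `t = 1/(n+1)` multiplies it by at most `(n+1) exp (‖a‖ +
-- ‖b‖)`.
open Filter Topology in
theorem NormedSpace.tendsto_exp_mul_exp_pow {𝔸 : Type*} [NormedRing 𝔸] [NormOneClass 𝔸]
    [NormedAlgebra ℝ 𝔸] [CompleteSpace 𝔸] (a b : 𝔸) :
    Tendsto (fun n : ℕ => (NormedSpace.exp (((n : ℝ) + 1)⁻¹ • a) *
      NormedSpace.exp (((n : ℝ) + 1)⁻¹ • b)) ^ (n + 1)) atTop (𝓝 (NormedSpace.exp (a + b))) := by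
  set f : ℝ → 𝔸 := fun t => NormedSpace.exp (t • (a + b)) -
    NormedSpace.exp (t • a) * NormedSpace.exp (t • b) with hf
  have hd : HasDerivAt f 0 0 := by
    have h := (hasDerivAt_exp_smul_const (𝕂 := ℝ) (a + b) 0).sub
      ((hasDerivAt_exp_smul_const (𝕂 := ℝ) a 0).mul (hasDerivAt_exp_smul_const (𝕂 := ℝ) b 0))
    simpa [hf, Pi.mul_def, Pi.sub_def] using h
  have hu : Tendsto (fun n : ℕ => ((n : ℝ) + 1)⁻¹) atTop (𝓝[≠] 0) := by
    refine tendsto_nhdsWithin_iff.2 ⟨?_, Eventually.of_forall fun n => ?_⟩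
    · simpa using tendsto_one_div_add_atTop_nhds_zero_nat (𝕜 := ℝ)
    · exact inv_ne_zero (by positivity)
  have h0 : f 0 = 0 := by simp [hf]
  have hlim := (hasDerivAt_iff_tendsto_slope.1 hd).comp hu
  rw [tendsto_iff_norm_sub_tendsto_zero]
  have hlim2 := hlim.norm.const_mul (Real.exp (‖a‖ + ‖b‖))
  rw [norm_zero, mul_zero] at hlim2
  refine squeeze_zero (fun _ => norm_nonneg _) (fun n => ?_) hlim2
  set t : ℝ := ((n : ℝ) + 1)⁻¹ with ht
  have htp : 0 < t := by positivity
  have htn : ((n : ℝ) + 1) * t = 1 := mul_inv_cancel₀ (by positivity)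
  have hexp : NormedSpace.exp (a + b) = NormedSpace.exp (t • (a + b)) ^ (n + 1) := by
    let := NormedAlgebra.restrictScalars ℚ ℝ 𝔸
    rw [← NormedSpace.exp_nsmul, ← Nat.cast_smul_eq_nsmul ℝ, smul_smul]
    push_cast
    rw [htn, one_smul]
  have hn : ∀ x : 𝔸, ‖NormedSpace.exp (t • x)‖ ≤ Real.exp (t * ‖x‖) := fun x => by
    simpa [norm_smul, abs_of_pos htp] using NormedSpace.norm_exp_le_exp_norm (t • x)
  have hx : ‖NormedSpace.exp (t • (a + b))‖ ≤ Real.exp (t * (‖a‖ + ‖b‖)) :=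
    (hn _).trans (Real.exp_le_exp.2 (by gcongr; exact norm_add_le _ _))
  have hy : ‖NormedSpace.exp (t • a) * NormedSpace.exp (t • b)‖
      ≤ Real.exp (t * (‖a‖ + ‖b‖)) := by
    refine (norm_mul_le _ _).trans ?_
    rw [mul_add, Real.exp_add]
    exact mul_le_mul (hn _) (hn _) (norm_nonneg _) (Real.exp_nonneg _)
  rw [hexp]
  refine (norm_pow_sub_pow_le hy hx n).trans ?_
  have hpow : Real.exp (t * (‖a‖ + ‖b‖)) ^ n ≤ Real.exp (‖a‖ + ‖b‖) := by
    rw [← Real.exp_nat_mul]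
    refine Real.exp_le_exp.2 ?_
    have h1 : (n : ℝ) * t ≤ 1 := by nlinarith
    have h2 : 0 ≤ ‖a‖ + ‖b‖ := by positivity
    nlinarith
  have hslope : ‖slope f 0 t‖ = ((n : ℝ) + 1) * ‖f t‖ := by
    rw [slope_def_module, h0, sub_zero, sub_zero, norm_smul, ht, inv_inv,
      Real.norm_of_nonneg (by positivity)]
  rw [Function.comp_apply, hslope, norm_sub_rev]
  calc ((n : ℝ) + 1) * Real.exp (t * (‖a‖ + ‖b‖)) ^ n * ‖f t‖
      ≤ ((n : ℝ) + 1) * Real.exp (‖a‖ + ‖b‖) * ‖f t‖ := by gcongr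
    _ = _ := by ring

namespace Matrix

variable {V : Type*} [Fintype V] [DecidableEq V]

theorem trace_mul_pow_comm (A B : Matrix V V ℝ) (m : ℕ) :
    ((A * B) ^ m).trace = ((B * A) ^ m).trace := by
  cases m with
  | zero => simp
  | succ m =>
    rw [pow_succ', mul_assoc, trace_mul_comm, ← mul_pow_mul, mul_assoc, ← pow_succ]

omit [DecidableEq V] in
theorem two_mul_trace_mul_le (A B : Matrix V V ℝ) :
    2 * (A * B).trace ≤ (Aᵀ * A).trace + (B * Bᵀ).trace := by
  have h : 0 ≤ ((Aᵀ - B) * (Aᵀ - B)ᵀ).trace := by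
    have := (posSemidef_self_mul_conjTranspose (Aᵀ - B)).trace_nonneg
    rwa [conjTranspose_eq_transpose_of_trivial] at this
  have h1 : (Aᵀ * Bᵀ).trace = (A * B).trace := by
    rw [← transpose_mul, trace_transpose, trace_mul_comm]
  rw [transpose_sub, transpose_transpose, Matrix.sub_mul, Matrix.mul_sub, Matrix.mul_sub,
    trace_sub, trace_sub, trace_sub, h1, trace_mul_comm B A] at h
  linarith

/-- The two claims feed each other. The first, applied to `M²`, produces powers of `(Mᵀ M)(M Mᵀ)`,
which the second and `two_mul_trace_mul_le` control. The second follows from the first at `M = X Y`,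
where `Y X² Y` is cyclically `X² Y²`. -/
theorem trace_pow_two_pow_le (k : ℕ) :
    (∀ M : Matrix V V ℝ, (M ^ 2 ^ (k + 1)).trace ≤ ((Mᵀ * M) ^ 2 ^ k).trace) ∧
    (∀ X Y : Matrix V V ℝ, X.IsSymm → Y.IsSymm →
      ((X * Y) ^ 2 ^ k).trace ≤ (X ^ 2 ^ k * Y ^ 2 ^ k).trace) := by
  induction k with
  | zero =>
    refine ⟨fun M => ?_, fun X Y _ _ => by simp⟩
    have := two_mul_trace_mul_le M M
    rw [trace_mul_comm M Mᵀ] at this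
    simp only [zero_add, pow_one, pow_zero, pow_two]
    linarith
  | succ k ih =>
    obtain ⟨ihM, ihXY⟩ := ih
    constructor
    · intro M
      have hs : (Mᵀ * M).IsSymm := isSymm_transpose_mul_self M
      have hs' : (M * Mᵀ).IsSymm := isSymm_mul_transpose_self M
      have h1 : (M ^ 2 ^ (k + 1 + 1)).trace ≤ (((Mᵀ * M) * (M * Mᵀ)) ^ 2 ^ k).trace := by
        have := ihM (M ^ 2)
        rw [← pow_mul, ← pow_succ'] at this
        refine this.trans (le_of_eq ?_)
        rw [transpose_pow, pow_two, pow_two, mul_assoc, trace_mul_pow_comm]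
        simp only [mul_assoc]
      have h2 := two_mul_trace_mul_le ((Mᵀ * M) ^ 2 ^ k) ((M * Mᵀ) ^ 2 ^ k)
      rw [transpose_pow, transpose_pow, hs.eq, hs'.eq, ← pow_add, ← pow_add, ← two_mul,
        ← pow_succ', trace_mul_pow_comm M Mᵀ] at h2
      linarith [ihXY _ _ hs hs']
    · intro X Y hX hY
      refine (ihM (X * Y)).trans ?_
      have h := ihXY (X ^ 2) (Y ^ 2) (hX.pow 2) (hY.pow 2)
      rw [← pow_mul, ← pow_mul, ← pow_succ'] at h
      refine le_trans (le_of_eq ?_) h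
      rw [transpose_mul, hX.eq, hY.eq, mul_assoc, trace_mul_pow_comm, pow_two, pow_two]
      simp only [mul_assoc]

open Filter Topology in
/-- The **Golden-Thompson inequality** for real symmetric matrices. -/
theorem trace_exp_add_le {A B : Matrix V V ℝ} (hA : A.IsSymm) (hB : B.IsSymm) :
    (NormedSpace.exp (A + B)).trace ≤ (NormedSpace.exp A * NormedSpace.exp B).trace := by
  rcases isEmpty_or_nonempty V with hV | hV
  · simp [trace]
  have ht : Tendsto (fun n : ℕ => (NormedSpace.exp (((n : ℝ) + 1)⁻¹ • A) *
      NormedSpace.exp (((n : ℝ) + 1)⁻¹ • B)) ^ (n + 1)) atTop (𝓝 (NormedSpace.exp (A + B))) := by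
    let := Matrix.linftyOpNormedRing (n := V) (α := ℝ)
    let := Matrix.linftyOpNormedAlgebra (n := V) (R := ℝ) (α := ℝ)
    have := Matrix.linfty_opNormOneClass (n := V) (α := ℝ)
    exact NormedSpace.tendsto_exp_mul_exp_pow A B
  -- The trace inequality is available only for exponents `2 ^ k`; the Lie-Trotter exponent is `n +
  -- 1`, hence the subsequence `n = 2 ^ k - 1`.
  have hsub : Tendsto (fun k : ℕ => 2 ^ k - 1) atTop atTop :=
    tendsto_atTop_mono (fun k => Nat.le_sub_one_of_lt Nat.lt_two_pow_self) tendsto_id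
  have hc : Continuous (trace : Matrix V V ℝ → ℝ) := continuous_id.matrix_trace
  refine le_of_tendsto ((hc.tendsto _).comp (ht.comp hsub)) (Eventually.of_forall fun k => ?_)
  have hk : 2 ^ k - 1 + 1 = 2 ^ k := Nat.sub_add_cancel Nat.one_le_two_pow
  have hk' : ((2 ^ k - 1 : ℕ) : ℝ) + 1 = (2 ^ k : ℕ) := by exact_mod_cast hk
  have hpow : ∀ C : Matrix V V ℝ,
      NormedSpace.exp ((((2 ^ k : ℕ) : ℝ))⁻¹ • C) ^ 2 ^ k = NormedSpace.exp C := fun C => by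
    rw [← Matrix.exp_nsmul, ← Nat.cast_smul_eq_nsmul ℝ, smul_smul,
      mul_inv_cancel₀ (by positivity), one_smul]
  simp only [Function.comp_apply, hk, hk']
  refine ((trace_pow_two_pow_le k).2 _ _ (IsSymm.exp (hA.smul _)) (IsSymm.exp (hB.smul _))).trans ?_
  rw [hpow, hpow]

end Matrix

/-! ### Traces of exponentials and rank-one perturbations -/

theorem IsIdempotentElem.exp_smul_eq {𝔸 : Type*} [NormedRing 𝔸] [NormedAlgebra ℝ 𝔸]
    [CompleteSpace 𝔸] {p : 𝔸} (hp : IsIdempotentElem p) (s : ℝ) :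
    NormedSpace.exp (s • p) = 1 + (Real.exp s - 1) • p := by
  have h1 := NormedSpace.exp_series_hasSum_exp' (𝕂 := ℝ) (s • p)
  have h2 := (NormedSpace.exp_series_hasSum_exp' (𝕂 := ℝ) s).smul_const p
  rw [← Real.exp_eq_exp_ℝ] at h2
  -- All powers of `p` equal `p` except the zeroth; `1 - p` corrects that term.
  have h3 := (hasSum_ite_eq (0 : ℕ) (1 - p)).add h2
  refine (h1.unique (h3.congr_fun ?_)).trans ?_
  · intro n
    rcases n with _ | n
    · simp
    · simp [smul_pow, hp.pow_succ_eq, smul_smul]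
  · rw [sub_smul, one_smul]; abel

namespace Matrix

variable {V : Type*} [Fintype V] [DecidableEq V]

/-- For `a ≠ 0`, normalizing gives an idempotent. For `a = 0` both sides are `1`. -/
theorem exp_smul_vecMulVec_self (a : V → ℝ) (c : ℝ) :
    NormedSpace.exp (c • vecMulVec a a)
      = 1 + ((Real.exp (c * (a ⬝ᵥ a)) - 1) / (a ⬝ᵥ a)) • vecMulVec a a := by
  by_cases h : a ⬝ᵥ a = 0
  · have : a = 0 := dotProduct_self_eq_zero.1 h
    simp [this]
  · have hp : IsIdempotentElem ((a ⬝ᵥ a)⁻¹ • vecMulVec a a) := by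
      rw [IsIdempotentElem, smul_mul_smul_comm, vecMulVec_mul_vecMulVec, vecMulVec_smul, smul_smul,
        mul_assoc, inv_mul_cancel₀ h, mul_one]
    have hc : c • vecMulVec a a = (c * (a ⬝ᵥ a)) • ((a ⬝ᵥ a)⁻¹ • vecMulVec a a) := by
      rw [smul_smul, mul_assoc, mul_inv_cancel₀ h, mul_one]
    rw [div_eq_mul_inv, ← smul_smul (Real.exp (c * (a ⬝ᵥ a)) - 1), hc]
    let := Matrix.linftyOpNormedRing (n := V) (α := ℝ)
    let := Matrix.linftyOpNormedAlgebra (n := V) (R := ℝ) (α := ℝ)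
    exact hp.exp_smul_eq _

omit [Fintype V] [DecidableEq V] in
theorem isSymm_vecMulVec_self (a : V → ℝ) : (vecMulVec a a).IsSymm :=
  transpose_vecMulVec a a

theorem trace_exp_add_smul_vecMulVec_le {A : Matrix V V ℝ} (hA : A.IsSymm) (a : V → ℝ) (c : ℝ) :
    (NormedSpace.exp (A + c • vecMulVec a a)).trace ≤ (NormedSpace.exp A).trace +
      ((Real.exp (c * (a ⬝ᵥ a)) - 1) / (a ⬝ᵥ a)) * (a ⬝ᵥ NormedSpace.exp A *ᵥ a) := by
  refine (trace_exp_add_le hA ((isSymm_vecMulVec_self a).smul c)).trans (le_of_eq ?_)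
  rw [exp_smul_vecMulVec_self, Matrix.mul_add, Matrix.mul_one, trace_add, Matrix.mul_smul,
    trace_smul, mul_vecMulVec, trace_vecMulVec, smul_eq_mul, dotProduct_comm (_ *ᵥ a)]

theorem posSemidef_exp {A : Matrix V V ℝ} (hA : A.IsSymm) : (NormedSpace.exp A).PosSemidef := by
  have hs : (NormedSpace.exp ((2 : ℝ)⁻¹ • A)).IsSymm := IsSymm.exp (hA.smul _)
  have h : NormedSpace.exp A
      = (NormedSpace.exp ((2 : ℝ)⁻¹ • A))ᴴ * NormedSpace.exp ((2 : ℝ)⁻¹ • A) := by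
    rw [conjTranspose_eq_transpose_of_trivial, hs.eq, ← pow_two, ← Matrix.exp_nsmul,
      ← Nat.cast_smul_eq_nsmul ℝ, smul_smul]
    norm_num
  rw [h]
  exact posSemidef_conjTranspose_mul_self _

/-- The trace is the sum of the positive numbers `exp (d i)` over the eigenvalues, so it dominates
each of them. -/
theorem dotProduct_mulVec_le_of_trace_exp_le {A : Matrix V V ℝ} (hA : A.IsSymm) {s : ℝ}
    (h : (NormedSpace.exp A).trace ≤ Real.exp s) (y : V → ℝ) :
    y ⬝ᵥ A *ᵥ y ≤ s * (y ⬝ᵥ y) := by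
  obtain ⟨U, d, hUU, hAU⟩ : ∃ (U : Matrix V V ℝ) (d : V → ℝ),
      Uᵀ * U = 1 ∧ A = U * diagonal d * Uᵀ := by
    have hH : A.IsHermitian := by
      rw [IsHermitian, conjTranspose_eq_transpose_of_trivial]; exact hA
    refine ⟨hH.eigenvectorUnitary, hH.eigenvalues, ?_, ?_⟩
    · have := Unitary.coe_star_mul_self hH.eigenvectorUnitary
      rwa [star_eq_conjTranspose, conjTranspose_eq_transpose_of_trivial] at this
    · have := hH.spectral_theorem
      rw [Unitary.conjStarAlgAut_apply, star_eq_conjTranspose,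
        conjTranspose_eq_transpose_of_trivial] at this
      exact this
  have hUU' : U * Uᵀ = 1 := mul_eq_one_comm.1 hUU
  have hinv : U⁻¹ = Uᵀ := inv_eq_left_inv hUU
  have htr : (NormedSpace.exp A).trace = ∑ i, Real.exp (d i) := by
    rw [hAU, ← hinv, Matrix.exp_conj _ _ (IsUnit.of_mul_eq_one _ hUU'), trace_mul_cycle, hinv, hUU,
      Matrix.one_mul, exp_diagonal, trace_diagonal]
    simp [NormedSpace.exp, Pi.coe_exp, Real.exp_eq_exp_ℝ]
  have hd : ∀ i, d i ≤ s := fun i => by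
    rw [htr] at h
    exact Real.exp_le_exp.1 ((Finset.single_le_sum (f := fun i => Real.exp (d i))
      (fun j _ => (Real.exp_pos (d j)).le) (Finset.mem_univ i)).trans h)
  have hq : y ⬝ᵥ A *ᵥ y = ∑ i, d i * (Uᵀ *ᵥ y) i ^ 2 := by
    rw [hAU, ← mulVec_mulVec, ← mulVec_mulVec, dotProduct_mulVec, ← mulVec_transpose, dotProduct]
    exact Finset.sum_congr rfl fun i _ => by rw [mulVec_diagonal]; ring
  have hy : y ⬝ᵥ y = ∑ i, (Uᵀ *ᵥ y) i ^ 2 := by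
    calc y ⬝ᵥ y = y ⬝ᵥ (U * Uᵀ) *ᵥ y := by rw [hUU', one_mulVec]
      _ = (Uᵀ *ᵥ y) ⬝ᵥ (Uᵀ *ᵥ y) := by
        rw [← mulVec_mulVec, dotProduct_mulVec, ← mulVec_transpose]
      _ = _ := Finset.sum_congr rfl fun i _ => (pow_two _).symm
  rw [hq, hy, Finset.mul_sum]
  gcongr with i
  exact hd i

end Matrix

/-! ### A matrix Chernoff bound for sums of independent rank-one matrices -/

theorem dotProduct_self_nonneg {V : Type*} [Fintype V] (x : V → ℝ) : 0 ≤ x ⬝ᵥ x :=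
  Finset.sum_nonneg fun i _ => mul_self_nonneg (x i)

theorem integrable_comp_of_finite {Ω β : Type*} [MeasurableSpace Ω] {P : Measure Ω}
    [IsProbabilityMeasure P] [Finite β] [MeasurableSpace β] [MeasurableSingletonClass β]
    {ξ : Ω → β} (hξ : Measurable ξ) (F : β → ℝ) : Integrable (fun ω => F (ξ ω)) P := by
  have := Measure.isProbabilityMeasure_map (μ := P) hξ.aemeasurable
  exact (Integrable.of_finite (f := F) (μ := P.map ξ)).comp_measurable hξ

/-- Adding an index `j` raises the trace by at most `g (ξ j) * q`, with `q ≥ 0` depending only on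
the earlier variables. Independence factors the expectation, and `hz` makes that of `g` nonpositive.
Finiteness of `α` settles all measurability and integrability. -/
theorem integral_trace_exp_sum_le {Ω ι V α : Type*} [MeasurableSpace Ω] {P : Measure Ω}
    [IsProbabilityMeasure P] [Finite ι] [Fintype V] [DecidableEq V] [Finite α] [MeasurableSpace α]
    [MeasurableSingletonClass α] {ξ : ι → Ω → α} (hξ : ∀ i, Measurable (ξ i))
    (hind : iIndepFun ξ P) (a : ι → V → ℝ) (z : ι → α → ℝ)
    (hz : ∀ i, ∫ ω, Real.exp (z i (ξ i ω) * (a i ⬝ᵥ a i)) ∂P ≤ 1) (s : Finset ι) :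
    ∫ ω, (NormedSpace.exp (∑ i ∈ s, z i (ξ i ω) • Matrix.vecMulVec (a i) (a i))).trace ∂P
      ≤ Fintype.card V := by
  classical
  have hsymm : ∀ (t : Finset ι) (b : ι → α),
      (∑ i ∈ t, z i (b i) • Matrix.vecMulVec (a i) (a i)).IsSymm := fun t b => by
    rw [Matrix.IsSymm, Matrix.transpose_sum]
    exact Finset.sum_congr rfl fun i _ => ((Matrix.isSymm_vecMulVec_self (a i)).smul _)
  have hξ' : Measurable (fun ω i => ξ i ω) := measurable_pi_lambda _ hξ
  have hint : ∀ F : (ι → α) → ℝ, Integrable (fun ω => F (fun i => ξ i ω)) P :=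
    fun F => integrable_comp_of_finite hξ' F
  induction s using Finset.induction_on with
  | empty => simp
  | insert j s hj ih =>
    set H : (ι → α) → Matrix V V ℝ :=
      fun b => NormedSpace.exp (∑ i ∈ s, z i (b i) • Matrix.vecMulVec (a i) (a i)) with hH
    set g : α → ℝ := fun x => (Real.exp (z j x * (a j ⬝ᵥ a j)) - 1) / (a j ⬝ᵥ a j) with hg
    set q : (ι → α) → ℝ := fun b => a j ⬝ᵥ H b *ᵥ a j with hq
    have hindep : IndepFun (fun ω => g (ξ j ω)) (fun ω => q (fun i => ξ i ω)) P := by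
      have h := hind.indepFun_finset {j} s (by simpa using hj) hξ
      let φ : (({j} : Finset ι) → α) → ℝ := fun b => g (b ⟨j, Finset.mem_singleton_self j⟩)
      let ψ : (s → α) → ℝ := fun b => a j ⬝ᵥ NormedSpace.exp
        (∑ i : s, z i (b i) • Matrix.vecMulVec (a i) (a i)) *ᵥ a j
      have h2 := h.comp (φ := φ) (ψ := ψ) (Measurable.of_discrete) (Measurable.of_discrete)
      have h3 : (fun ω => g (ξ j ω)) = φ ∘ fun ω (i : ({j} : Finset ι)) => ξ i ω := rfl
      rw [h3]
      convert h2 using 1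
      funext ω
      simp only [hq, hH, ψ, Function.comp_apply]
      rw [← Finset.sum_coe_sort s (fun i => z i (ξ i ω) • Matrix.vecMulVec (a i) (a i))]
    have hgint : ∫ ω, g (ξ j ω) ∂P ≤ 0 := by
      rw [hg, integral_div, integral_sub (integrable_comp_of_finite (hξ j)
        (fun x => Real.exp (z j x * (a j ⬝ᵥ a j)))) (integrable_const _)]
      refine div_nonpos_of_nonpos_of_nonneg ?_ (dotProduct_self_nonneg _)
      simpa using hz j
    have hqint : 0 ≤ ∫ ω, q (fun i => ξ i ω) ∂P := integral_nonneg fun ω => by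
      simpa using (Matrix.posSemidef_exp (hsymm s (fun i => ξ i ω))).dotProduct_mulVec_nonneg (a j)
    calc ∫ ω, (NormedSpace.exp
          (∑ i ∈ insert j s, z i (ξ i ω) • Matrix.vecMulVec (a i) (a i))).trace ∂P
        ≤ ∫ ω, ((H (fun i => ξ i ω)).trace + g (ξ j ω) * q (fun i => ξ i ω)) ∂P := by
          refine integral_mono (hint fun b => (NormedSpace.exp
            (∑ i ∈ insert j s, z i (b i) • Matrix.vecMulVec (a i) (a i))).trace)
            (hint fun b => (H b).trace + g (b j) * q b) fun ω => ?_
          simp only [Finset.sum_insert hj]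
          rw [add_comm]
          exact Matrix.trace_exp_add_smul_vecMulVec_le (hsymm s _) _ _
      _ = ∫ ω, (H (fun i => ξ i ω)).trace ∂P
          + (∫ ω, g (ξ j ω) ∂P) * ∫ ω, q (fun i => ξ i ω) ∂P := by
          rw [integral_add (hint fun b => (H b).trace) (hint fun b => g (b j) * q b),
            hindep.integral_fun_mul_eq_mul_integral
              (integrable_comp_of_finite (hξ j) g).aestronglyMeasurable
              (hint q).aestronglyMeasurable]
      _ ≤ Fintype.card V := by
          have := mul_nonpos_of_nonpos_of_nonneg hgint hqint
          linarith

theorem ProbabilityTheory.iIndepSet.iIndepFun_mem {Ω ι : Type*} [MeasurableSpace Ω] {P : Measure Ω}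
    {E : ι → Set Ω} (h : iIndepSet E P) : iIndepFun (fun i ω => ω ∈ E i) P := by
  rw [iIndepSet_iff_iIndep] at h
  rw [iIndepFun_iff_iIndep]
  convert h using 2 with i
  exact (MeasurableSpace.generateFrom_singleton _).symm

theorem bernoulli_mgf_le {p x : ℝ} (hp : 0 ≤ p) (hx : |x| ≤ 1) :
    1 + p * (Real.exp x - 1) ≤ Real.exp (p * x + p * x ^ 2) := by
  have h1 : Real.exp x - 1 ≤ x + x ^ 2 := by
    have := (abs_le.1 (Real.abs_exp_sub_one_sub_id_le hx)).2
    linarith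
  have h2 := Real.add_one_le_exp (p * x + p * x ^ 2)
  have h3 := mul_le_mul_of_nonneg_left h1 hp
  linarith

theorem exists_sampling_bound {Ω ι V : Type*} [MeasurableSpace Ω] {P : Measure Ω}
    [IsProbabilityMeasure P] [Fintype ι] [Fintype V] [Nonempty V]
    {E : ι → Set Ω} (hE : ∀ i, MeasurableSet (E i)) (hind : iIndepSet E P) {a : ι → V → ℝ}
    (ha : ∀ y, ∑ i, (a i ⬝ᵥ y) ^ 2 ≤ y ⬝ᵥ y) {lam θ : ℝ} (hlam : 0 < lam) (hθ : |θ| ≤ lam)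
    (hp : ∀ i, P.real (E i) = min 1 (lam * (a i ⬝ᵥ a i))) :
    ∃ B : Set Ω, P.real B ≤ 1 / Fintype.card V ∧ ∀ᵐ ω ∂P, ω ∉ B → ∀ y : V → ℝ,
      θ * ∑ i, ((E i).indicator 1 ω / P.real (E i) - 1) * (a i ⬝ᵥ y) ^ 2
        ≤ (2 * Real.log (Fintype.card V) + θ ^ 2 / lam) * (y ⬝ᵥ y) := by
  classical
  have hn : (0 : ℝ) < Fintype.card V := by exact_mod_cast Fintype.card_pos
  set τ : ι → ℝ := fun i => a i ⬝ᵥ a i with hτ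
  have hτ0 : ∀ i, 0 ≤ τ i := fun i => dotProduct_self_nonneg _
  -- The shift `-θ² / lam` brings the exponential moment down to at most `1`; it is paid back at the
  -- end through `ha`. Indices sampled with probability one get `0`.
  set z : ι → Prop → ℝ := fun i b => if lam * τ i < 1 then
    θ * ((if b then 1 else 0) / (lam * τ i) - 1) - θ ^ 2 / lam else 0 with hzdef
  set ξ : ι → Ω → Prop := fun i ω => ω ∈ E i with hξ
  have hξm : ∀ i, Measurable (ξ i) := fun i => (hE i).mem
  have hz : ∀ i, ∫ ω, Real.exp (z i (ξ i ω) * (a i ⬝ᵥ a i)) ∂P ≤ 1 := by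
    intro i
    by_cases h1 : lam * τ i < 1
    swap
    · simp [hzdef, h1]
    rcases (hτ0 i).eq_or_lt with h0 | h0
    · have : a i ⬝ᵥ a i = 0 := h0.symm
      simp [this]
    have hpi : P.real (E i) = lam * τ i := by rw [hp, min_eq_right h1.le]
    -- `r` is the exponent when `i` is not sampled; sampling adds `τ i * θ / (lam * τ i) = θ / lam`.
    set r : ℝ := -(θ * τ i + θ ^ 2 / lam * τ i) with hr
    have hval : ∀ ω, Real.exp (z i (ξ i ω) * (a i ⬝ᵥ a i))
        = Real.exp r * (1 + (E i).indicator 1 ω * (Real.exp (θ / lam) - 1)) := by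
      intro ω
      by_cases hω : ω ∈ E i
      · have : z i (ξ i ω) * (a i ⬝ᵥ a i) = r + θ / lam := by
          simp only [hzdef, hξ, hω, h1, if_true, hr]
          change _ * τ i = _
          field_simp
          ring
        rw [this, Real.exp_add]
        simp [hω]
      · have : z i (ξ i ω) * (a i ⬝ᵥ a i) = r := by
          simp only [hzdef, hξ, hω, h1, if_true, if_false, hr]
          change _ * τ i = _
          ring
        rw [this]
        simp [hω]
    have hii : Integrable ((E i).indicator (1 : Ω → ℝ)) P :=
      (integrable_const (1 : ℝ)).indicator (hE i)
    simp_rw [hval]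
    rw [integral_const_mul, integral_add (integrable_const _) (hii.mul_const _), integral_mul_const,
      integral_indicator_one (hE i), hpi]
    have hb := bernoulli_mgf_le (p := lam * τ i) (x := θ / lam) (by positivity) (by
      rw [abs_div, abs_of_pos hlam]; exact (div_le_one hlam).2 hθ)
    have he : lam * τ i * (θ / lam) + lam * τ i * (θ / lam) ^ 2 = -r := by
      rw [hr]; field_simp
    rw [he] at hb
    calc _ ≤ Real.exp r * Real.exp (-r) := by
          gcongr
          simpa using hb
      _ = 1 := by rw [← Real.exp_add]; simp
  have hmain := integral_trace_exp_sum_le hξm hind.iIndepFun_mem a z hz Finset.univ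
  set S : Ω → Matrix V V ℝ := fun ω => ∑ i, z i (ξ i ω) • Matrix.vecMulVec (a i) (a i) with hS
  have hSsymm : ∀ ω, (S ω).IsSymm := fun ω => by
    rw [hS, Matrix.IsSymm, Matrix.transpose_sum]
    exact Finset.sum_congr rfl fun i _ => ((Matrix.isSymm_vecMulVec_self (a i)).smul _)
  -- Against a mean of at most `n`, the threshold `n² = exp (2 log n)` is exceeded with probability
  -- at most `1 / n`.
  set N : ℝ := (Fintype.card V : ℝ) ^ 2 with hN
  refine ⟨{ω | N ≤ (NormedSpace.exp (S ω)).trace}, ?_, ?_⟩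
  · have hmk := mul_meas_ge_le_integral_of_nonneg (μ := P)
      (f := fun ω => (NormedSpace.exp (S ω)).trace)
      (ae_of_all _ fun ω => (Matrix.posSemidef_exp (hSsymm ω)).trace_nonneg)
      (integrable_comp_of_finite (measurable_pi_lambda _ hξm) fun b : ι → Prop =>
        (NormedSpace.exp (∑ i, z i (b i) • Matrix.vecMulVec (a i) (a i))).trace) N
    have h2 := hmk.trans hmain
    rw [le_div_iff₀ hn]
    have h4 : N * P.real {ω | N ≤ (NormedSpace.exp (S ω)).trace} = Fintype.card V *
        (Fintype.card V * P.real {ω | N ≤ (NormedSpace.exp (S ω)).trace}) := by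
      rw [← mul_assoc, ← pow_two]
    rw [h4] at h2
    have h3 := le_of_mul_le_mul_left (h2.trans_eq (mul_one _).symm) hn
    rwa [mul_comm] at h3
  · have hone : ∀ᵐ ω ∂P, ∀ i, 1 ≤ lam * τ i → ω ∈ E i := by
      rw [ae_all_iff]
      intro i
      by_cases h1 : 1 ≤ lam * τ i
      · have h2 : P (E i) = 1 := by
          have h3 := hp i
          rw [min_eq_left h1] at h3
          exact (ENNReal.toReal_eq_one_iff _).1 h3
        filter_upwards [(prob_compl_eq_zero_iff (hE i)).2 h2 |> compl_mem_ae_iff.2] with ω hω _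
        simpa using hω
      · exact ae_of_all _ fun ω h => absurd h h1
    filter_upwards [hone] with ω hω hωB y
    have htr : (NormedSpace.exp (S ω)).trace ≤ Real.exp (2 * Real.log (Fintype.card V)) := by
      have h1 := (not_le.1 hωB).le
      have h2 : N = Real.exp (2 * Real.log (Fintype.card V)) := by
        rw [two_mul, Real.exp_add, Real.exp_log hn, hN, pow_two]
      exact h1.trans_eq h2
    have hq := Matrix.dotProduct_mulVec_le_of_trace_exp_le (hSsymm ω) htr y
    have hqe : y ⬝ᵥ S ω *ᵥ y = ∑ i, z i (ξ i ω) * (a i ⬝ᵥ y) ^ 2 := by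
      rw [hS, Matrix.sum_mulVec, dotProduct_sum]
      refine Finset.sum_congr rfl fun i _ => ?_
      rw [Matrix.smul_mulVec, dotProduct_smul, Matrix.vecMulVec_mulVec, dotProduct_comm y,
        op_smul_eq_smul, smul_dotProduct, smul_eq_mul, smul_eq_mul, pow_two]
    rw [hqe] at hq
    have hterm : ∀ i, θ * (((E i).indicator 1 ω / P.real (E i) - 1) * (a i ⬝ᵥ y) ^ 2)
        ≤ z i (ξ i ω) * (a i ⬝ᵥ y) ^ 2 + θ ^ 2 / lam * (a i ⬝ᵥ y) ^ 2 := by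
      intro i
      rw [hp]
      by_cases h1 : lam * τ i < 1
      · have hzi : z i (ξ i ω)
            = θ * ((E i).indicator 1 ω / (lam * τ i) - 1) - θ ^ 2 / lam := by
          simp only [hzdef, hξ, h1, if_true, Set.indicator_apply, Pi.one_apply]
        rw [min_eq_right h1.le, hzi]
        exact le_of_eq (by ring)
      · have h2 := hω i (not_lt.1 h1)
        have hzi : z i (ξ i ω) = 0 := by simp only [hzdef, h1, if_false]
        rw [min_eq_left (not_lt.1 h1), hzi]
        simp only [h2, Set.indicator_of_mem, Pi.one_apply, div_one, sub_self, zero_mul, mul_zero,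
          zero_add]
        positivity
    rw [Finset.mul_sum]
    refine (Finset.sum_le_sum fun i _ => hterm i).trans ?_
    rw [Finset.sum_add_distrib, ← Finset.mul_sum, add_mul]
    gcongr
    exact ha y

/-- Rank-one **matrix Chernoff bound** for importance sampling by leverage scores. -/
theorem measureReal_leverage_sampling {Ω ι V : Type*} [MeasurableSpace Ω] {P : Measure Ω}
    [IsProbabilityMeasure P] [Fintype ι] [Fintype V] [Nonempty V]
    {E : ι → Set Ω} (hE : ∀ i, MeasurableSet (E i)) (hind : iIndepSet E P) {a : ι → V → ℝ}
    (ha : ∀ y, ∑ i, (a i ⬝ᵥ y) ^ 2 ≤ y ⬝ᵥ y) {lam ε : ℝ} (hlam : 0 < lam) (hε : 0 < ε)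
    (hε1 : ε ≤ 1) (hp : ∀ i, P.real (E i) = min 1 (lam * (a i ⬝ᵥ a i)))
    (hlog : 8 * Real.log (Fintype.card V) ≤ ε ^ 2 * lam) :
    1 - 2 / (Fintype.card V : ℝ) ≤ P.real {ω | ∀ y : V → ℝ,
      |∑ i, ((E i).indicator 1 ω / P.real (E i) - 1) * (a i ⬝ᵥ y) ^ 2| ≤ ε * (y ⬝ᵥ y)} := by
  -- Then `θ² / lam` is half of `θ ε = ε² lam / 2`; the other half must cover `2 log n`, whence the
  -- constant `8`.
  set θ : ℝ := ε * lam / 2 with hθ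
  have hθ0 : 0 < θ := by positivity
  have hθle : |θ| ≤ lam := by
    rw [abs_of_pos hθ0, hθ]; nlinarith
  have hbound : 2 * Real.log (Fintype.card V) + θ ^ 2 / lam ≤ θ * ε := by
    have : θ ^ 2 / lam = ε ^ 2 * lam / 4 := by rw [hθ]; field_simp; ring
    rw [this, hθ]; linarith
  obtain ⟨B₁, hB₁, h₁⟩ := exists_sampling_bound hE hind ha hlam hθle hp
  obtain ⟨B₂, hB₂, h₂⟩ := exists_sampling_bound hE hind ha hlam ((abs_neg θ).trans_le hθle) hp
  set A := {ω | ∀ y : V → ℝ,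
      |∑ i, ((E i).indicator 1 ω / P.real (E i) - 1) * (a i ⬝ᵥ y) ^ 2| ≤ ε * (y ⬝ᵥ y)} with hA
  -- Covering the space and using subadditivity avoids having to prove `A` measurable.
  have hcover : (Set.univ : Set Ω) ≤ᵐ[P] (A ∪ (B₁ ∪ B₂) : Set Ω) := by
    filter_upwards [h₁, h₂] with ω hω₁ hω₂ _
    by_cases hb : ω ∈ B₁ ∪ B₂
    · exact Or.inr hb
    rw [Set.mem_union, not_or] at hb
    refine Or.inl fun y => ?_
    have hy : 0 ≤ y ⬝ᵥ y := dotProduct_self_nonneg _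
    have g₁ := hω₁ hb.1 y
    have g₂ := hω₂ hb.2 y
    rw [neg_sq] at g₂
    have g := mul_le_mul_of_nonneg_right hbound hy
    rw [abs_le]
    constructor
    · refine le_of_mul_le_mul_left ?_ hθ0
      linarith
    · refine le_of_mul_le_mul_left ?_ hθ0
      linarith
  have h := ENNReal.toReal_mono (measure_ne_top P _) (measure_mono_ae hcover)
  have hu : (P Set.univ).toReal = 1 := by simp
  rw [hu] at h
  have h3 : P.real (A ∪ (B₁ ∪ B₂)) ≤ P.real A + (P.real B₁ + P.real B₂) :=
    (measureReal_union_le _ _).trans (by gcongr; exact measureReal_union_le _ _)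
  have h4 : (2 : ℝ) / Fintype.card V = 1 / Fintype.card V + 1 / Fintype.card V := by ring
  have h5 : 1 ≤ P.real (A ∪ (B₁ ∪ B₂)) := h
  linarith

/-! ### Graph Laplacians -/

open scoped Classical in
theorem SimpleGraph.sum_sum_adj_eq_two_mul_sum_edgeSet {V : Type*} [Fintype V] (G : SimpleGraph V)
    (F : Sym2 V → ℝ) :
    ∑ u, ∑ v, (if G.Adj u v then F s(u, v) else 0) = 2 * ∑ f : G.edgeSet, F f := by
  rw [← Fintype.sum_prod_type' (fun u v => if G.Adj u v then F s(u, v) else 0),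
    ← Finset.sum_filter, ← Finset.sum_fiberwise_of_maps_to
      (g := fun p : V × V => s(p.1, p.2)) (t := G.edgeFinset) (by simp), Finset.mul_sum,
    ← Finset.sum_coe_sort G.edgeFinset]
  refine Fintype.sum_equiv (Equiv.subtypeEquivRight fun f => G.mem_edgeFinset) _ _ ?_
  rintro ⟨f, hf⟩
  induction f using Sym2.ind with | _ a b
  have hab : G.Adj a b := by simpa using hf
  have hset : {p ∈ Finset.univ.filter (fun p : V × V => G.Adj p.1 p.2) | s(p.1, p.2) = s(a, b)}
      = {(a, b), (b, a)} := by
    ext ⟨u, v⟩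
    simp only [Finset.mem_filter, Finset.mem_univ, true_and, Sym2.eq_iff, Finset.mem_insert,
      Finset.mem_singleton, Prod.mk.injEq]
    constructor
    · exact fun h => h.2
    · rintro (⟨rfl, rfl⟩ | ⟨rfl, rfl⟩)
      · exact ⟨hab, Or.inl ⟨rfl, rfl⟩⟩
      · exact ⟨hab.symm, Or.inr ⟨rfl, rfl⟩⟩
  change ∑ p ∈ {p ∈ Finset.univ.filter (fun p : V × V => G.Adj p.1 p.2) | s(p.1, p.2) = s(a, b)},
    F s(p.1, p.2) = 2 * F s(a, b)
  rw [hset, Finset.sum_pair (by simpa using fun h => absurd h hab.ne), Sym2.eq_swap (a := b)]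
  ring

/-- The signed indicator `χ_u - χ_v` of a pair of vertices, with an arbitrary orientation. -/
noncomputable def edgeVector {V : Type*} [DecidableEq V] (f : Sym2 V) : V → ℝ :=
  Pi.single f.out.1 1 - Pi.single f.out.2 1

theorem edgeVector_dotProduct {V : Type*} [Fintype V] [DecidableEq V] (f : Sym2 V) (x : V → ℝ) :
    edgeVector f ⬝ᵥ x = x f.out.1 - x f.out.2 := by
  simp [edgeVector, sub_dotProduct]

theorem edgeVector_dotProduct_sq {V : Type*} [Fintype V] [DecidableEq V] (u v : V) (x : V → ℝ) :
    (edgeVector s(u, v) ⬝ᵥ x) ^ 2 = (x u - x v) ^ 2 := by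
  have h : s(s(u, v).out.1, s(u, v).out.2) = s(u, v) := Quot.out_eq _
  rw [edgeVector_dotProduct]
  rcases Sym2.eq_iff.1 h with ⟨h1, h2⟩ | ⟨h1, h2⟩
  · rw [h1, h2]
  · rw [h1, h2]; ring

theorem edgeResistance_eq {V : Type*} [Fintype V] [DecidableEq V] (G : SimpleGraph V)
    (w : Sym2 V → ℝ) (f : Sym2 V) : edgeResistance G w f =
      edgeVector f ⬝ᵥ moorePenrose (weightedLaplacian G w) *ᵥ edgeVector f := by
  have h : f = s(f.out.1, f.out.2) := (Quot.out_eq f).symm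
  conv_lhs => rw [h]
  rfl

open scoped Classical in
theorem energy_eq_sum_sum {V : Type*} [Fintype V] [DecidableEq V] (G : SimpleGraph V)
    (w : Sym2 V → ℝ) (x : V → ℝ) :
    2 * energy G w x = ∑ u, ∑ v, if G.Adj u v then w s(u, v) * (x u - x v) ^ 2 else 0 := by
  set m : V → V → ℝ := fun u v => if G.Adj u v then w s(u, v) else 0 with hm
  have hsymm : ∀ u v, m u v = m v u := fun u v => by
    simp only [hm, G.adj_comm u v, Sym2.eq_swap (a := u)]
  have hL : ∀ u v, weightedLaplacian G w u v = (if u = v then weightedDegree G w u else 0) - m u v := by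
    intro u v
    by_cases huv : u = v
    · subst huv; simp [weightedLaplacian, hm]
    · by_cases h : G.Adj u v <;> simp [weightedLaplacian, hm, huv, h]
  have h1 : energy G w x = ∑ u, ∑ v, m u v * (x u ^ 2 - x u * x v) := by
    rw [energy, dotProduct]
    refine Finset.sum_congr rfl fun u _ => ?_
    simp only [Matrix.mulVec, dotProduct, hL, sub_mul, ite_mul, zero_mul, Finset.sum_sub_distrib,
      Finset.sum_ite_eq, Finset.mem_univ, if_true]
    simp only [weightedDegree, mul_sub, Finset.sum_mul, Finset.mul_sum, Finset.sum_sub_distrib]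
    congr 1
    · exact Finset.sum_congr rfl fun v _ => by simp only [hm]; ring
    · exact Finset.sum_congr rfl fun v _ => by ring
  -- Exchanging `u` and `v` gives a second form; adding it to the first completes the square.
  have h2 : energy G w x = ∑ u, ∑ v, m u v * (x v ^ 2 - x u * x v) := by
    rw [h1, Finset.sum_comm]
    exact Finset.sum_congr rfl fun u _ => Finset.sum_congr rfl fun v _ => by rw [hsymm]; ring
  rw [two_mul]
  nth_rewrite 1 [h1]
  rw [h2, ← Finset.sum_add_distrib]
  refine Finset.sum_congr rfl fun u _ => ?_
  rw [← Finset.sum_add_distrib]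
  refine Finset.sum_congr rfl fun v _ => ?_
  by_cases h : G.Adj u v
  · simp only [hm, h, if_true]; ring
  · simp [hm, h]

open scoped Classical in
theorem energy_eq_sum_edgeSet {V : Type*} [Fintype V] [DecidableEq V] (G : SimpleGraph V)
    (w : Sym2 V → ℝ) (x : V → ℝ) :
    energy G w x = ∑ f : G.edgeSet, w f * (edgeVector (f : Sym2 V) ⬝ᵥ x) ^ 2 := by
  have h := energy_eq_sum_sum G w x
  simp_rw [← edgeVector_dotProduct_sq] at h
  rw [G.sum_sum_adj_eq_two_mul_sum_edgeSet (fun f => w f * (edgeVector f ⬝ᵥ x) ^ 2)] at h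
  linarith

-- The discarded edges have weight zero.
open scoped Classical in
theorem energy_reweightedSubgraph {V : Type*} [Fintype V] [DecidableEq V] (G : SimpleGraph V)
    {w : Sym2 V → ℝ} (hw : ∀ f ∈ G.edgeSet, 0 ≤ w f) (x : V → ℝ) :
    energy (reweightedSubgraph G w) w x = energy G w x := by
  have h : 2 * energy (reweightedSubgraph G w) w x = 2 * energy G w x := by
    rw [energy_eq_sum_sum, energy_eq_sum_sum]
    refine Finset.sum_congr rfl fun u _ => Finset.sum_congr rfl fun v _ => ?_
    by_cases h : G.Adj u v
    · rcases (hw s(u, v) h).eq_or_lt with h0 | h0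
      · simp [← h0]
      · have : (reweightedSubgraph G w).Adj u v := by
          simp [reweightedSubgraph, h, h0, h.ne]
        simp [this, h]
    · have : ¬ (reweightedSubgraph G w).Adj u v := by
        simp [reweightedSubgraph, h]
      simp [this, h]
  linarith

/-- Isotropic position: there are vectors `a f` of squared length `w f * R f` and a map `x ↦ y x`
with `‖y x‖² = xᵀ L x` that turns the edge terms of the energy into squared inner products. -/
theorem exists_isotropic_vectors {V : Type*} [Fintype V] [DecidableEq V] (G : SimpleGraph V)
    [Fintype G.edgeSet] {w : Sym2 V → ℝ} (hw : ∀ f ∈ G.edgeSet, 0 ≤ w f) :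
    ∃ (a : G.edgeSet → V → ℝ) (y : (V → ℝ) → V → ℝ),
      (∀ f, a f ⬝ᵥ a f = w f * edgeResistance G w f) ∧
      (∀ t, ∑ f, (a f ⬝ᵥ t) ^ 2 ≤ t ⬝ᵥ t) ∧
      (∀ x, y x ⬝ᵥ y x = energy G w x) ∧
      (∀ f x, (a f ⬝ᵥ y x) ^ 2 = w f * (edgeVector (f : Sym2 V) ⬝ᵥ x) ^ 2) := by
  have hen : ∀ x, energy G w x = ∑ f : G.edgeSet, w f * (edgeVector (f : Sym2 V) ⬝ᵥ x) ^ 2 := by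
    intro x
    rw [energy_eq_sum_edgeSet]
    exact Finset.sum_congr (by ext; simp) fun _ _ => rfl
  set L := weightedLaplacian G w with hLdef
  have hLs : L.IsSymm := weightedLaplacian_isSymm G w
  set Q := moorePenrose L with hQdef
  have hMP : IsMoorePenrose L Q := moorePenrose_spec hLs
  -- Since `L` is symmetric, `Qᵀ` also satisfies the Penrose equations; uniqueness concludes.
  have hQs : Q.IsSymm := by
    have : IsMoorePenrose L Qᵀ := by
      refine ⟨?_, ?_, ?_, ?_⟩
      · have := congrArg Matrix.transpose hMP.mul_mul_left
        simpa [Matrix.transpose_mul, hLs.eq, Matrix.mul_assoc] using this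
      · have := congrArg Matrix.transpose hMP.mul_mul_right
        simpa [Matrix.transpose_mul, hLs.eq, Matrix.mul_assoc] using this
      · have := hMP.symm_right
        rw [Matrix.transpose_mul, hLs.eq] at this
        rw [Matrix.transpose_mul, Matrix.transpose_transpose, hLs.eq, this]
      · have := hMP.symm_left
        rw [Matrix.transpose_mul, hLs.eq] at this
        rw [Matrix.transpose_mul, Matrix.transpose_transpose, hLs.eq, this]
    exact this.unique hMP
  have hsa : ∀ (A : Matrix V V ℝ), A.IsSymm → ∀ x z, x ⬝ᵥ A *ᵥ z = (A *ᵥ x) ⬝ᵥ z := by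
    intro A hA x z
    rw [Matrix.dotProduct_mulVec, ← Matrix.mulVec_transpose, hA.eq]
  have hen0 : ∀ x, 0 ≤ x ⬝ᵥ L *ᵥ x := fun x => by
    change 0 ≤ energy G w x
    rw [hen]
    exact Finset.sum_nonneg fun f _ => mul_nonneg (hw f f.2) (sq_nonneg _)
  have hQpos : Q.PosSemidef := by
    refine Matrix.PosSemidef.of_dotProduct_mulVec_nonneg
      (by rw [Matrix.IsHermitian, Matrix.conjTranspose_eq_transpose_of_trivial]; exact hQs)
      fun x => ?_
    have h := hen0 (Q *ᵥ x)
    rw [← hsa Q hQs, Matrix.mulVec_mulVec, Matrix.mulVec_mulVec, hMP.mul_mul_right] at h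
    simpa using h
  obtain ⟨B, hB⟩ : ∃ B : Matrix V V ℝ, Q = Bᵀ * B := by
    open scoped MatrixOrder in
    obtain ⟨B, hB⟩ := CStarAlgebra.nonneg_iff_eq_star_mul_self.1 hQpos.nonneg
    exact ⟨B, by rwa [Matrix.star_eq_conjTranspose,
      Matrix.conjTranspose_eq_transpose_of_trivial] at hB⟩
  have hBd : ∀ x z, (B *ᵥ x) ⬝ᵥ (B *ᵥ z) = x ⬝ᵥ Q *ᵥ z := fun x z => by
    rw [hB, ← Matrix.mulVec_mulVec, Matrix.dotProduct_mulVec x, ← Matrix.mulVec_transpose,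
      Matrix.transpose_transpose]
  have hsq : ∀ f : G.edgeSet, √(w f) * √(w f) = w f := fun f => Real.mul_self_sqrt (hw f f.2)
  -- `Q L x - x` lies in the kernel of `L`, so its energy, a sum of nonnegative terms, vanishes edge
  -- by edge. The factor `√(w f)` is kept because zero-weight edges are allowed.
  have hker : ∀ (x : V → ℝ) (f : G.edgeSet), √(w f) * (edgeVector (f : Sym2 V) ⬝ᵥ Q *ᵥ L *ᵥ x)
      = √(w f) * (edgeVector (f : Sym2 V) ⬝ᵥ x) := by
    intro x f
    set r := Q *ᵥ L *ᵥ x - x with hr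
    have hLr : L *ᵥ r = 0 := by
      rw [hr, Matrix.mulVec_sub, Matrix.mulVec_mulVec, Matrix.mulVec_mulVec, 
        hMP.mul_mul_left, sub_self]
    have h0 : ∑ f : G.edgeSet, w f * (edgeVector (f : Sym2 V) ⬝ᵥ r) ^ 2 = 0 := by
      rw [← hen, energy, ← hLdef, hLr, dotProduct_zero]
    have hf := (Finset.sum_eq_zero_iff_of_nonneg
      fun (f : G.edgeSet) _ => mul_nonneg (hw f f.2) (sq_nonneg _)).1 h0 f (Finset.mem_univ _)
    have hf2 : (√(w f) * (edgeVector (f : Sym2 V) ⬝ᵥ r)) ^ 2 = 0 := by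
      rw [mul_pow, pow_two √(w f), hsq, hf]
    have hf3 := pow_eq_zero_iff (two_ne_zero) |>.1 hf2
    rw [hr, dotProduct_sub, mul_sub] at hf3
    linarith
  refine ⟨fun f => √(w f) • B *ᵥ edgeVector (f : Sym2 V), fun x => B *ᵥ L *ᵥ x, ?_, ?_, ?_, ?_⟩
  · intro f
    rw [smul_dotProduct, dotProduct_smul, hBd, edgeResistance_eq, smul_eq_mul, smul_eq_mul,
      ← mul_assoc, hsq]
  · intro t
    have hsum : ∑ f : G.edgeSet, ((√(w f) • B *ᵥ edgeVector (f : Sym2 V)) ⬝ᵥ t) ^ 2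
        = (Bᵀ *ᵥ t) ⬝ᵥ L *ᵥ Bᵀ *ᵥ t := by
      change _ = energy G w (Bᵀ *ᵥ t)
      rw [hen]
      refine Finset.sum_congr rfl fun f _ => ?_
      rw [smul_dotProduct, smul_eq_mul, mul_pow, pow_two √(w f), hsq, Matrix.dotProduct_mulVec,
        Matrix.vecMul_transpose]
    rw [hsum]
    -- `B L Bᵀ` is an orthogonal projection: `p ⬝ᵥ p = t ⬝ᵥ p`, hence `t ⬝ᵥ p ≤ t ⬝ᵥ t`.
    set p := B *ᵥ L *ᵥ Bᵀ *ᵥ t with hp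
    have h1 : (Bᵀ *ᵥ t) ⬝ᵥ L *ᵥ Bᵀ *ᵥ t = t ⬝ᵥ p := by
      rw [hp, Matrix.dotProduct_mulVec t, ← Matrix.mulVec_transpose]
    have h2 : p ⬝ᵥ p = t ⬝ᵥ p := by
      rw [hp, hBd, ← hsa L hLs, ← h1]
      congr 1
      rw [Matrix.mulVec_mulVec, Matrix.mulVec_mulVec, hMP.mul_mul_left]
    have h3 := dotProduct_self_nonneg (t - p)
    rw [sub_dotProduct, dotProduct_sub, dotProduct_sub, dotProduct_comm p t, h2] at h3
    rw [h1]
    linarith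
  · intro x
    change (B *ᵥ L *ᵥ x) ⬝ᵥ (B *ᵥ L *ᵥ x) = x ⬝ᵥ L *ᵥ x
    rw [hBd, ← hsa L hLs, Matrix.mulVec_mulVec, Matrix.mulVec_mulVec, 
      hMP.mul_mul_left]
  · intro f x
    change ((√(w f) • B *ᵥ edgeVector (f : Sym2 V)) ⬝ᵥ (B *ᵥ L *ᵥ x)) ^ 2 = _
    rw [smul_dotProduct, hBd, smul_eq_mul, hker, mul_pow, pow_two √(w f), hsq]

/-- If `λ ≥ 8 ε⁻² log n`, sampling by effective resistances fails to give an `ε`-spectral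
sparsifier with probability at most `2 / n`. -/
theorem measureReal_isSpectralSparsifier {V Ω : Type*} [Fintype V] [DecidableEq V] [Nonempty V]
    (G : SimpleGraph V) {w : Sym2 V → ℝ} {ε lam : ℝ} (hw : ∀ f ∈ G.edgeSet, 0 ≤ w f)
    (hlam : 0 < lam) (hε : 0 < ε) (hε1 : ε ≤ 1)
    (hlog : 8 * Real.log (Fintype.card V) ≤ ε ^ 2 * lam)
    [MeasurableSpace Ω] {P : Measure Ω} [IsProbabilityMeasure P] {S : Ω → Set (Sym2 V)}
    (hS : ∀ f ∈ G.edgeSet, MeasurableSet {ω | f ∈ S ω})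
    (hp : ∀ f ∈ G.edgeSet, P.real {ω | f ∈ S ω} = sampleProb G w lam f)
    (hind : iIndepSet (fun f : G.edgeSet => {ω | (f : Sym2 V) ∈ S ω}) P) :
    1 - 2 / (Fintype.card V : ℝ) ≤
      P.real {ω | IsSpectralSparsifier ε G w (sampledWeight G w lam (S ω))} := by
  classical
  obtain ⟨a, y, ha, hiso, hy, hay⟩ := exists_isotropic_vectors G hw
  have hpa : ∀ f : G.edgeSet,
      P.real {ω | (f : Sym2 V) ∈ S ω} = min 1 (lam * (a f ⬝ᵥ a f)) := fun f => by
    rw [hp f f.2, sampleProb, ha, mul_assoc]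
  refine (measureReal_leverage_sampling (fun f : G.edgeSet => hS f f.2) hind hiso hlam hε hε1 hpa
    hlog).trans (measureReal_mono fun ω hω => ?_)
  have hnn : ∀ f ∈ G.edgeSet, 0 ≤ sampledWeight G w lam (S ω) f := by
    intro f hf
    rw [sampledWeight, ← hp f hf]
    split_ifs
    · exact div_nonneg (hw f hf) measureReal_nonneg
    · exact le_rfl
  have hdiff : ∀ x, energy (reweightedSubgraph G (sampledWeight G w lam (S ω)))
      (sampledWeight G w lam (S ω)) x - energy G w x = ∑ f : G.edgeSet,
        ({ω | (f : Sym2 V) ∈ S ω}.indicator 1 ω / P.real {ω | (f : Sym2 V) ∈ S ω} - 1) *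
          (a f ⬝ᵥ y x) ^ 2 := by
    intro x
    rw [energy_reweightedSubgraph G hnn, energy_eq_sum_edgeSet, energy_eq_sum_edgeSet,
      ← Finset.sum_sub_distrib]
    refine Finset.sum_congr (by ext; simp) fun f _ => ?_
    rw [hay, hp f f.2, sampledWeight, Set.indicator_apply]
    by_cases h : (f : Sym2 V) ∈ S ω
    · simp only [h, if_true, Set.mem_ofPred_eq, Pi.one_apply]; ring
    · simp only [h, if_false, Set.mem_ofPred_eq]; ring
  refine ⟨hnn, fun x => ?_⟩
  have h := hω (y x)
  rw [← hdiff, hy, abs_le] at h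
  constructor
  · linarith [h.1]
  · linarith [h.2]

theorem mainTheorem2 :
    ∃ C : ℝ, 0 < C ∧ ∃ K : ℝ, 0 < K ∧
      ∀ (V : Type*) [Fintype V] [DecidableEq V] (G : SimpleGraph V) (w : Sym2 V → ℝ)
        (ε lam : ℝ),
        G.Connected →
        (∀ f ∈ G.edgeSet, 0 ≤ w f) →
        1 / (Fintype.card V : ℝ) ≤ ε → ε ≤ 1 / 2 →
        C * (Real.log (Fintype.card V)) ^ 3 / ε ^ 4 ≤ lam →
        ∀ (Ω : Type*) [MeasurableSpace Ω] (P : Measure Ω) [IsProbabilityMeasure P]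
          (S : Ω → Set (Sym2 V)),
          (∀ f ∈ G.edgeSet, MeasurableSet {ω | f ∈ S ω}) →
          (∀ f ∈ G.edgeSet, P.real {ω | f ∈ S ω} = sampleProb G w lam f) →
          iIndepSet (fun f : G.edgeSet => {ω | (f : Sym2 V) ∈ S ω}) P →
          1 - K * Real.log (Fintype.card V) / (Fintype.card V : ℝ) ≤
            P.real {ω | IsSpectralSparsifier ε G w (sampledWeight G w lam (S ω))} := by
  -- `8` comes from the Chernoff bound; `4` works because `n ≥ 2` gives `log n ≥ 1/2`, so `2 / n ≤ 4
  -- log n / n`.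
  refine ⟨8, by norm_num, 4, by norm_num, ?_⟩
  intro V _ _ G w ε lam hconn hw hε hε2 hlam Ω _ P _ S hS hp hind
  have := hconn.nonempty
  have hn : (0 : ℝ) < Fintype.card V := by exact_mod_cast Fintype.card_pos
  have hn2 : (2 : ℝ) ≤ Fintype.card V := by
    have h := hε.trans hε2
    rw [div_le_div_iff₀ hn two_pos] at h
    linarith
  have hε0 : 0 < ε := lt_of_lt_of_le (by positivity) hε
  have hlogn : 1 / 2 ≤ Real.log (Fintype.card V) := by
    have := Real.log_le_log two_pos hn2
    linarith [Real.log_two_gt_d9]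
  set l := Real.log (Fintype.card V) with hl
  have hl0 : 0 < l := by linarith
  have hlam0 : 0 < lam := lt_of_lt_of_le (by positivity) hlam
  have hlog : 8 * l ≤ ε ^ 2 * lam := by
    -- From `ε ≤ 1/2 ≤ log n`, the surplus factor `log² n / ε²` in the hypothesis on `lam` is at
    -- least `1`.
    have h1 : ε ^ 2 ≤ l ^ 2 := by gcongr; linarith
    have h2 : ε ^ 2 * (8 * l ^ 3 / ε ^ 4) = 8 * l * (l ^ 2 / ε ^ 2) := by field_simp
    have h3 : 1 ≤ l ^ 2 / ε ^ 2 := (one_le_div (by positivity)).2 h1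
    calc 8 * l ≤ 8 * l * (l ^ 2 / ε ^ 2) := le_mul_of_one_le_right (by positivity) h3
      _ = ε ^ 2 * (8 * l ^ 3 / ε ^ 4) := h2.symm
      _ ≤ ε ^ 2 * lam := by gcongr
  refine le_trans ?_ (measureReal_isSpectralSparsifier G hw hlam0 hε0 (by linarith) hlog hS hp hind)
  have h4 : 2 / (Fintype.card V : ℝ) ≤ 4 * l / Fintype.card V := by gcongr; linarith
  linarith
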